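/- Let $R$ be a commutative Noetherian ring with $1$ and let $M$ be a unital $R$-module with maximal orders, i.e. for every nonzero $x \in M$, every prime ideal of $R$ containing $\mathrm{ann}_R(x)$ is maximal. Let $E(M)$ be the injective envelope of $M$, i.e. an injective $R$-module containing $M$ as an essential submodule (every nonzero submodule of $E(M)$ meets $M$ nontrivially). If $E(M)$ is co-Hopfian (every injective $R$-endomorphism of it is an automorphism), then $M$ is co-Hopfian. -/

import Mathlib

universe u v

/-- A module is co-Hopfian if every injective endomorphism of it is an automorphism. -/
def IsCoHopfian (R : Type u) (M : Type v) [Ring R] [AddCommGroup M] [Module R M] : Prop :=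
  ∀ f : M →ₗ[R] M, Function.Injective f → Function.Bijective f

/-- A module over a commutative ring has maximal orders if, for each nonzero `x`, every prime ideal
containing the annihilator of `x` (in Mathlib `Ideal.torsionOf R M x`) is maximal. -/
def HasMaximalOrders (R : Type u) (M : Type v) [CommRing R] [AddCommGroup M] [Module R M] : Prop :=
  ∀ x : M, x ≠ 0 → ∀ P : Ideal R, P.IsPrime → Ideal.torsionOf R M x ≤ P → P.IsMaximal

/-- The map `i : M → E` exhibits `E` as an injective envelope of `M`: the module `E` is injective,
`i` is a monomorphism, and `E` is an essential extension of the image of `i`, that is, every nonzero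
submodule of `E` meets this image nontrivially.

The universe of `E` is at least that of `R`, so that `Module.Injective` (which tests extension only
along modules in the universe of `E`) is injectivity in the usual sense; it is large enough for
every `M` to have an injective envelope. -/
structure IsInjectiveEnvelope {R : Type u} {M : Type v} {E : Type (max u v)} [Ring R]
    [AddCommGroup M] [Module R M] [AddCommGroup E] [Module R E] (i : M →ₗ[R] E) : Prop where
  injective_module : Module.Injective R E
  injective_map : Function.Injective i
  essential : ∀ N : Submodule R E, N ≠ ⊥ → N ⊓ LinearMap.range i ≠ ⊥

/-! Write `M[I]` for the elements of `M` killed by an ideal `I`. An injective endomorphism of `M`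
preserves `M[I]`; with `I = ann x`, it reaches `x` as soon as `M[I]` is Artinian. Noetherian
induction on `I` reduces this to `M[m]` for `m` maximal, which embeds in `E[m]`. An injective
endomorphism of `E[m]`, extended by the identity on a complement up to essential extension, extends
further to an injective endomorphism of `E`. Hence the `R ⧸ m`-space `E[m]` inherits co-Hopficity
and is finite-dimensional. -/

/-- Every submodule `V` is contained, up to essential extension, in a direct sum `V ⊕ W`. -/
theorem Submodule.exists_disjoint_sup_essential {R : Type*} {E : Type*} [Ring R] [AddCommGroup E]
    [Module R E] (V : Submodule R E) :
    ∃ W : Submodule R E, Disjoint V W ∧ ∀ N : Submodule R E, Disjoint (V ⊔ W) N → N = ⊥ := by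
  obtain ⟨W, hW⟩ := zorn_le₀ {W : Submodule R E | Disjoint V W} fun c hc hchain =>
    ⟨sSup c, hchain.directedOn.disjoint_sSup_right.2 fun _ hb => hc hb, fun _ hz => le_sSup hz⟩
  refine ⟨W, hW.prop, fun N hN => ?_⟩
  have hle : W ⊔ N ≤ W :=
    hW.le_of_ge (hW.prop.disjoint_sup_right_of_disjoint_sup_left hN) le_sup_left
  exact disjoint_self.1 (hN.mono_left ((le_sup_right.trans hle).trans le_sup_right))

/-- In a co-Hopfian injective module, the range of an injective endomorphism of a submodule `V`
is essential in `V`. -/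
theorem IsCoHopfian.eq_bot_of_disjoint_map_range {R : Type*} {E : Type*} [Ring R] [AddCommGroup E]
    [Module R E] (hinj : Module.Injective R E) (hE : IsCoHopfian R E) (V : Submodule R E)
    (g : V →ₗ[R] V) (hg : Function.Injective g) (U : Submodule R V)
    (hU : Disjoint U (LinearMap.range g)) : U = ⊥ := by
  obtain ⟨W, hVW, hess⟩ := V.exists_disjoint_sup_essential
  have hadd : ∀ v ∈ V, ∀ w ∈ W, v + w = 0 → v = 0 ∧ w = 0 := by
    intro v hv w hw h
    have hv0 : v = 0 := by
      refine Submodule.disjoint_def.1 hVW v hv ?_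
      rw [eq_neg_of_add_eq_zero_left h]
      exact W.neg_mem hw
    exact ⟨hv0, by simpa [hv0] using h⟩
  -- `h` extends `g ⊕ id` from `V ⊕ W` to `E`. It is injective because it is so on the essential
  -- submodule `V ⊕ W`.
  obtain ⟨h, hh⟩ := hinj.out (V.subtype.coprod W.subtype)
    (by
      rw [← LinearMap.ker_eq_bot, LinearMap.ker_eq_bot']
      rintro ⟨v, w⟩ hvw
      obtain ⟨hv, hw⟩ := hadd v v.2 w w.2 (by simpa using hvw)
      exact Prod.ext (Subtype.ext hv) (Subtype.ext hw))
    ((V.subtype ∘ₗ g).coprod W.subtype)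
  have hh' : ∀ (v : V) (w : W), h (v + w) = g v + w := fun v w => by simpa using hh (v, w)
  have hker : LinearMap.ker h = ⊥ := by
    refine hess _ (Submodule.disjoint_def.2 fun x hx hx0 => ?_)
    obtain ⟨v, hv, w, hw, rfl⟩ := Submodule.mem_sup.1 hx
    rw [LinearMap.mem_ker, hh' ⟨v, hv⟩ ⟨w, hw⟩] at hx0
    obtain ⟨h1, h2⟩ := hadd _ (g ⟨v, hv⟩).2 w hw hx0
    have : (⟨v, hv⟩ : V) = 0 := hg (by rw [map_zero]; exact Subtype.ext h1)
    rw [show v = 0 from congrArg Subtype.val this, h2, add_zero]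
  have hbij := hE h (LinearMap.ker_eq_bot.1 hker)
  -- If `g v + w` lies in `U`, then `w = 0` and `g v` lies in `U ⊓ range g = ⊥`. So the preimage of
  -- `U` misses `V ⊕ W` and vanishes; surjectivity of `h` then kills `U`.
  have hcomap : (U.map V.subtype).comap h = ⊥ := by
    refine hess _ (Submodule.disjoint_def.2 fun x hx hxU => ?_)
    obtain ⟨v, hv, w, hw, rfl⟩ := Submodule.mem_sup.1 hx
    obtain ⟨u, hu, hux⟩ := hxU
    rw [hh' ⟨v, hv⟩ ⟨w, hw⟩] at hux
    obtain ⟨h1, h2⟩ := hadd ((g ⟨v, hv⟩ - u : V) : E) (g ⟨v, hv⟩ - u).2 w hw (by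
      rw [Submodule.coe_sub, show (u : E) = g ⟨v, hv⟩ + w from hux]; abel)
    have hgu : g ⟨v, hv⟩ = u := sub_eq_zero.1 (Subtype.ext h1)
    have hu0 : u = 0 := Submodule.disjoint_def.1 hU u hu ⟨_, hgu⟩
    have : (⟨v, hv⟩ : V) = 0 := hg (by rw [map_zero, hgu, hu0])
    rw [show v = 0 from congrArg Subtype.val this, h2, add_zero]
  rw [Submodule.eq_bot_iff]
  intro u hu
  obtain ⟨e, he⟩ := hbij.2 u
  have he0 : e = 0 := by
    rw [← Submodule.mem_bot R, ← hcomap]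
    exact ⟨u, hu, he.symm⟩
  exact Subtype.ext (by rw [← V.subtype_apply, V.subtype_apply, ← he, he0, map_zero]; rfl)

/-- A semisimple submodule of a co-Hopfian injective module is co-Hopfian. -/
theorem IsCoHopfian.of_isSemisimpleModule {R : Type*} {E : Type*} [Ring R] [AddCommGroup E]
    [Module R E] (hinj : Module.Injective R E) (hE : IsCoHopfian R E) (V : Submodule R E)
    [IsSemisimpleModule R V] : IsCoHopfian R V := by
  intro g hg
  obtain ⟨U, hU⟩ := exists_isCompl (LinearMap.range g)
  have hbot := hE.eq_bot_of_disjoint_map_range hinj V g hg U hU.disjoint.symm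
  exact ⟨hg, LinearMap.range_eq_top.1 (by simpa [hbot] using hU.sup_eq_top)⟩

/-- A co-Hopfian vector space is finite-dimensional. -/
theorem IsCoHopfian.finite {K V : Type*} [Field K] [AddCommGroup V] [Module K V]
    (hV : IsCoHopfian K V) : Module.Finite K V := by
  let b := Module.Basis.ofVectorSpace K V
  by_contra hfin
  have : Infinite (Module.Basis.ofVectorSpaceIndex K V) := by
    by_contra hι
    have := not_infinite_iff_finite.1 hι
    exact hfin (Module.Finite.of_basis b)
  obtain ⟨s, hs, hs'⟩ : ∃ s : Module.Basis.ofVectorSpaceIndex K V →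
      Module.Basis.ofVectorSpaceIndex K V, Function.Injective s ∧ ¬ Function.Surjective s := by
    -- A bijection from `Option ι` to the infinite index set `ι` restricts to a shift missing `e
    -- none`.
    obtain ⟨e⟩ := Cardinal.eq.1
      (Cardinal.mk_option.trans (Cardinal.add_one_eq (Cardinal.infinite_iff.1 this)))
    refine ⟨fun j => e (some j), e.injective.comp (Option.some_injective _), fun hsurj => ?_⟩
    obtain ⟨j, hj⟩ := hsurj (e none)
    exact Option.some_ne_none j (e.injective hj)
  let f : V →ₗ[K] V := b.repr.symm.toLinearMap ∘ₗ Finsupp.lmapDomain K K s ∘ₗ b.repr.toLinearMap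
  have hf : Function.Injective f :=
    b.repr.symm.injective.comp ((Finsupp.mapDomain_injective hs).comp b.repr.injective)
  refine hs' fun j => ?_
  obtain ⟨v, hv⟩ := (hV f hf).2 (b j)
  have hv' : Finsupp.mapDomain s (b.repr v) = Finsupp.single j 1 := by
    apply b.repr.symm.injective
    simpa [f] using hv
  by_contra hj
  have h0 := Finsupp.mapDomain_of_notMem_range (b.repr v) j hj
  rw [hv', Finsupp.single_eq_same] at h0
  exact one_ne_zero h0

/-- In a co-Hopfian injective module, the elements killed by a maximal ideal form an Artinian
module. -/
theorem IsCoHopfian.isArtinian_torsionBySet {R : Type*} {E : Type*} [CommRing R] [AddCommGroup E]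
    [Module R E] (hinj : Module.Injective R E) (hE : IsCoHopfian R E) (m : Ideal R)
    [hm : m.IsMaximal] : IsArtinian R (Submodule.torsionBySet R E m) := by
  let : Field (R ⧸ m) := Ideal.Quotient.field m
  have htor := Submodule.torsionBySet_isTorsionBySet (R := R) (M := E) (m : Set R)
  have : IsSemisimpleModule R (Submodule.torsionBySet R E m) :=
    htor.isSemisimpleModule_iff.1 inferInstance
  have hco := hE.of_isSemisimpleModule hinj (Submodule.torsionBySet R E m)
  have hcoK : IsCoHopfian (R ⧸ m) (Submodule.torsionBySet R E m) := fun g hg =>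
    hco { toFun := g
          map_add' := map_add g
          map_smul' := fun r x => map_smul g (Ideal.Quotient.mk m r) x } hg
  have := hcoK.finite
  exact (htor.semilinearMap.isArtinian_iff_of_bijective Function.bijective_id).2 inferInstance

/-- If the elements killed by any maximal ideal form an Artinian module, then so do the elements
killed by an ideal with only maximal primes above it. -/
theorem Submodule.isArtinian_torsionBySet_of_isMaximal {R M : Type*} [CommRing R]
    [IsNoetherianRing R] [AddCommGroup M] [Module R M]
    (hM : ∀ m : Ideal R, m.IsMaximal → IsArtinian R (Submodule.torsionBySet R M m))
    (I : Ideal R) (hI : ∀ P : Ideal R, P.IsPrime → I ≤ P → P.IsMaximal) :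
    IsArtinian R (Submodule.torsionBySet R M I) := by
  induction I using IsNoetherian.induction with
  | hgt I ih =>
  by_cases htop : I = ⊤
  · have : Subsingleton (Submodule.torsionBySet R M I) := by
      refine subsingleton_of_forall_eq 0 fun x => Subtype.ext ?_
      simpa using (Submodule.mem_torsionBySet_iff _ _).1 x.2 ⟨1, by simp [htop]⟩
    infer_instance
  by_cases hprime : Ideal.IsPrime I
  · exact hM I (hI I hprime le_rfl)
  obtain ⟨a, ha, b, hb, hab⟩ := (Ideal.not_isPrime_iff.1 hprime).resolve_left htop
  -- Both ideals strictly contain `I`, and multiplication by `a` gives an exact sequence `0 → M[J] →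
  -- M[I] → M[J']`.
  let J : Ideal R := I ⊔ Ideal.span {a}
  let J' : Ideal R := I.colon {a}
  have haJ : a ∈ J := Ideal.mem_sup_right (Ideal.mem_span_singleton_self a)
  have hIJ : I ≤ J := le_sup_left
  have hIJ' : I ≤ J' := fun r hr => Submodule.mem_colon_singleton.2 (Ideal.mul_mem_right a I hr)
  have hbJ' : b ∈ J' := Submodule.mem_colon_singleton.2 (by rwa [smul_eq_mul, mul_comm])
  have := ih J (lt_of_le_not_ge hIJ fun h => ha (h haJ)) fun P hP h => hI P hP (hIJ.trans h)
  have := ih J' (lt_of_le_not_ge hIJ' fun h => hb (h hbJ')) fun P hP h => hI P hP (hIJ'.trans h)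
  have hsmul : ∀ x ∈ Submodule.torsionBySet R M I, a • x ∈ Submodule.torsionBySet R M J' := by
    intro x hx
    refine (Submodule.mem_torsionBySet_iff _ _).2 fun c => ?_
    rw [← mul_smul]
    exact (Submodule.mem_torsionBySet_iff _ _).1 hx ⟨c * a, Submodule.mem_colon_singleton.1 c.2⟩
  refine isArtinian_of_range_eq_ker
    (Submodule.inclusion (Submodule.torsionBySet_le_torsionBySet_of_subset hIJ))
    ((LinearMap.lsmul R M a).restrict hsmul) ?_
  rw [Submodule.range_inclusion]
  ext ⟨x, hx⟩
  simp only [Submodule.mem_comap, Submodule.subtype_apply, LinearMap.mem_ker]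
  constructor
  · intro hxJ
    exact Subtype.ext ((Submodule.mem_torsionBySet_iff _ _).1 hxJ ⟨a, haJ⟩)
  · intro hax
    have hax' : a • x = 0 := congrArg Subtype.val hax
    refine (Submodule.mem_torsionBySet_iff _ _).2 fun ⟨c, hc⟩ => ?_
    obtain ⟨r, hr, s, hs, rfl⟩ := Submodule.mem_sup.1 hc
    obtain ⟨t, rfl⟩ := Ideal.mem_span_singleton'.1 hs
    have hrx : r • x = 0 := (Submodule.mem_torsionBySet_iff _ _).1 hx ⟨r, hr⟩
    change (r + t * a) • x = 0
    rw [add_smul, mul_smul, hax', hrx, smul_zero, add_zero]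

theorem corollary1p4 {R : Type u} [CommRing R] [IsNoetherianRing R]
    {M : Type v} [AddCommGroup M] [Module R M] (hM : HasMaximalOrders R M)
    {E : Type (max u v)} [AddCommGroup E] [Module R E] (i : M →ₗ[R] E)
    (hi : IsInjectiveEnvelope i) (hE : IsCoHopfian R E) :
    IsCoHopfian R M := by
  have hart : ∀ m : Ideal R, m.IsMaximal → IsArtinian R (Submodule.torsionBySet R M m) := by
    intro m hm
    have := hE.isArtinian_torsionBySet hi.injective_module m
    have hmem : ∀ x ∈ Submodule.torsionBySet R M m, i x ∈ Submodule.torsionBySet R E m := by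
      intro x hx
      refine (Submodule.mem_torsionBySet_iff _ _).2 fun a => ?_
      rw [← map_smul, (Submodule.mem_torsionBySet_iff _ _).1 hx a, map_zero]
    exact isArtinian_of_injective (i.restrict hmem) fun x y hxy =>
      Subtype.ext (hi.injective_map (congrArg Subtype.val hxy))
  refine fun f hf => ⟨hf, fun x => ?_⟩
  by_cases hx : x = 0
  · exact ⟨0, by rw [map_zero, hx]⟩
  have := Submodule.isArtinian_torsionBySet_of_isMaximal hart (Ideal.torsionOf R M x) (hM x hx)
  have hmem : ∀ y ∈ Submodule.torsionBySet R M (Ideal.torsionOf R M x),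
      f y ∈ Submodule.torsionBySet R M (Ideal.torsionOf R M x) := by
    intro y hy
    refine (Submodule.mem_torsionBySet_iff _ _).2 fun a => ?_
    rw [← map_smul, (Submodule.mem_torsionBySet_iff _ _).1 hy a, map_zero]
  obtain ⟨y, hy⟩ := (IsArtinian.bijective_of_injective_endomorphism (f.restrict hmem)
    fun y z hyz => Subtype.ext (hf (congrArg Subtype.val hyz))).2
    ⟨x, (Submodule.mem_torsionBySet_iff _ _).2 fun a => (Ideal.mem_torsionOf_iff x a.1).1 a.2⟩
  exact ⟨y, congrArg Subtype.val hy⟩
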